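/- Let $R$ be a (not necessarily commutative) unital ring which is purely infinite simple, i.e. $R$ is simple and for every nonzero $x\in R$ there are $s,t\in R$ such that $sxt$ is an infinite idempotent. (An idempotent $p$ is infinite if $p=q+r$ with $q,r$ orthogonal idempotents, $r\neq 0$, and there are $x\in pRq$, $y\in qRp$ with $xy=p$, $yx=q$.) Write $U(R)$ for the group of units of $R$, $GL(R)=\operatorname{colim}_n GL_n(R)$ for the stable general linear group, and $K_1(R)=GL(R)^{ab}$. For $G=U$ or $G=GL$ let $G(R)^0\subset G(R)$ be the normal subgroup of those $g$ for which there is $w(t)\in G(R[t])$ with $w(0)=1$ and $w(1)=g$, and put $\pi_0(U(R))=U(R)/U(R)^0$ (the group of polynomially connected components of $U(R)$) and $KV_1(R)=GL(R)/GL(R)^0$. (1) The canonical homomorphism $\pi_0(U(R))\to KV_1(R)$ induced by the inclusion $U(R)=GL_1(R)\subset GL(R)$ is an isomorphism. (2) If moreover $R$ is $K_1$-regular, i.e. the canonical map $K_1(R)\to K_1(R[t_1,\dots,t_m])$ is an isomorphism for every $m\geq 0$, then there is an isomorphism of groups $e:K_1(R)\to\pi_0(U(R))$ which is the canonical one: $e([u])=[u]$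 for every $u\in U(R)$, and for every $g\in GL(R)$ the image of $e([g])$ under $\pi_0(U(R))\to KV_1(R)$ is the class of $g$. -/

import Mathlib

noncomputable section

namespace UnitalRing

universe u

/-! ### Purely infinite simple rings -/

section PurelyInfinite

variable {R : Type u} [Ring R]

/-- Murray-von Neumann equivalence of idempotents `p`, `q`: there are `x ∈ pRq` and `y ∈ qRp`
with `xy = p` and `yx = q`. -/
def MvNEquiv (p q : R) : Prop :=
  ∃ x y : R, p * x * q = x ∧ q * y * p = y ∧ x * y = p ∧ y * x = q

/-- An idempotent `p` is infinite if it is the sum of two orthogonal idempotents `q`, `r`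
with `p ∼ q` and `r ≠ 0`. -/
def IsInfiniteIdempotent (p : R) : Prop :=
  IsIdempotentElem p ∧ ∃ q r : R, IsIdempotentElem q ∧ IsIdempotentElem r ∧
    q * r = 0 ∧ r * q = 0 ∧ p = q + r ∧ MvNEquiv p q ∧ r ≠ 0

variable (R) in
/-- A unital ring is purely infinite simple if it is simple and for every `x ≠ 0` there are
`s`, `t` such that `s x t` is an infinite idempotent. -/
structure IsPurelyInfiniteSimple : Prop where
  simple : IsSimpleRing R
  exists_infinite : ∀ x : R, x ≠ 0 → ∃ s t : R, IsInfiniteIdempotent (s * x * t)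

end PurelyInfinite

/-! ### The stable general linear group -/

section Stable

variable {R : Type u} [Ring R] {S : Type u} [Ring S]

/-- The matrix `diag(A, 1)` of size `n ≥ m`, for `A` of size `m`. -/
def stabMatrix {m n : ℕ} (A : Matrix (Fin m) (Fin m) R) : Matrix (Fin n) (Fin n) R :=
  fun i j => if h : (i : ℕ) < m ∧ (j : ℕ) < m then A ⟨i, h.1⟩ ⟨j, h.2⟩ else if i = j then 1 else 0

theorem stabMatrix_one {m n : ℕ} :
    (stabMatrix (1 : Matrix (Fin m) (Fin m) R) : Matrix (Fin n) (Fin n) R) = 1 := by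
  ext i j
  unfold stabMatrix
  split_ifs with h h' <;> simp_all [Matrix.one_apply, Fin.ext_iff]

theorem stabMatrix_mul {m n : ℕ} (hmn : m ≤ n) (A B : Matrix (Fin m) (Fin m) R) :
    (stabMatrix (A * B) : Matrix (Fin n) (Fin n) R) = stabMatrix A * stabMatrix B := by
  ext i j
  by_cases hi : (i : ℕ) < m
  · have key : (stabMatrix A * stabMatrix B : Matrix (Fin n) (Fin n) R) i j
        = ∑ k : Fin m, A ⟨i, hi⟩ k *
            (stabMatrix B : Matrix (Fin n) (Fin n) R) (Fin.castLE hmn k) j := by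
      rw [Matrix.mul_apply]
      symm
      apply Finset.sum_of_injOn (Fin.castLE hmn)
      · exact (Fin.castLE_injective hmn).injOn
      · intro k _; simp
      · intro k _ hk
        have hk' : ¬ (k : ℕ) < m := fun h => hk ⟨⟨k, h⟩, by simp, by ext; simp⟩
        have : i ≠ k := fun h => hk' (h ▸ hi)
        simp [stabMatrix, hk', this]
      · intro k _
        simp [stabMatrix, hi]
    rw [key]
    by_cases hj : (j : ℕ) < m
    · simp [stabMatrix, hi, hj, Matrix.mul_apply]
    · have hij : i ≠ j := fun h => hj (h ▸ hi)
      have hk : ∀ k : Fin m, Fin.castLE hmn k ≠ j := fun k h => hj (by rw [← h]; simp)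
      simp [stabMatrix, hj, hij, hk]
  · rw [Matrix.mul_apply, Finset.sum_eq_single i]
    · simp [stabMatrix, hi]
    · intro k _ hk
      simp [stabMatrix, hi, hk.symm]
    · simp

variable (R) in
/-- The group `GL_n(R)` of invertible `n × n` matrices. -/
abbrev GLn (n : ℕ) : Type u := (Matrix (Fin n) (Fin n) R)ˣ

variable (R) in
/-- The inclusion `GL_m(R) → GL_n(R)`, `A ↦ diag(A, 1)`, for `m ≤ n`. -/
def GLn.stab (m n : ℕ) (h : m ≤ n) : GLn R m →* GLn R n :=
  Units.map
    { toFun := stabMatrix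
      map_one' := stabMatrix_one
      map_mul' := stabMatrix_mul h }

instance GLn.directedSystem : DirectedSystem (GLn R) (GLn.stab R · · ·) where
  map_self m A := by
    ext i j
    simp [GLn.stab, stabMatrix]
  map_map k j i hij hjk A := by
    ext a b
    simp only [GLn.stab, stabMatrix, Units.coe_map, MonoidHom.coe_mk, OneHom.coe_mk]
    split_ifs <;> first | rfl | omega | simp_all [Fin.ext_iff]

variable (R) in
/-- The stable general linear group `GL(R) = colim_n GL_n(R)`. -/
abbrev StableGL : Type u := DirectLimit (GLn R) (GLn.stab R)

variable (R) in
/-- The canonical map `GL_n(R) → GL(R)`. -/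
def StableGL.of (n : ℕ) : GLn R n →* StableGL R where
  toFun A := ⟦⟨n, A⟩⟧
  map_one' := (DirectLimit.one_def n).symm
  map_mul' A B := (DirectLimit.mul_def n A B).symm

/-- The map `GL_n(R) → GL_n(S)` obtained by applying a ring homomorphism to all entries. -/
def GLn.map (f : R →+* S) (n : ℕ) : GLn R n →* GLn S n :=
  Units.map (f.mapMatrix : Matrix (Fin n) (Fin n) R →+* Matrix (Fin n) (Fin n) S).toMonoidHom

theorem GLn.map_stab (f : R →+* S) (m n : ℕ) (h : m ≤ n) (A : GLn R m) :
    GLn.stab S m n h (GLn.map f m A) = GLn.map f n (GLn.stab R m n h A) := by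
  ext i j
  simp only [GLn.stab, GLn.map, stabMatrix, Units.coe_map, MonoidHom.coe_mk, OneHom.coe_mk,
    RingHom.toMonoidHom_eq_coe, MonoidHom.coe_coe, RingHom.mapMatrix_apply, Matrix.map_apply]
  split_ifs <;> simp

/-- The map `GL(R) → GL(S)` induced by a ring homomorphism. -/
def StableGL.map (f : R →+* S) : StableGL R →* StableGL S where
  toFun := DirectLimit.map (GLn.stab R) (GLn.stab S) (fun n A => GLn.map f n A)
    (fun m n h A => GLn.map_stab f m n h A)
  map_one' := by
    rw [DirectLimit.one_def 0, DirectLimit.one_def 0]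
    exact congrArg (StableGL.of S 0) (map_one (GLn.map f 0))
  map_mul' := DirectLimit.induction₂ _ fun n A B => by
    rw [DirectLimit.mul_def]
    exact congrArg (StableGL.of S n) (map_mul (GLn.map f n) A B) |>.trans (map_mul (StableGL.of S n) _ _)

theorem StableGL.map_of (f : R →+* S) (n : ℕ) (A : GLn R n) :
    StableGL.map f (StableGL.of R n A) = StableGL.of S n (GLn.map f n A) := rfl

variable (R) in
/-- The canonical map `U(R) = GL_1(R) → GL(R)`. -/
def StableGL.ofUnits : Rˣ →* StableGL R :=
  (StableGL.of R 1).comp (Units.map (Matrix.scalar (Fin 1) : R →+* Matrix (Fin 1) (Fin 1) R).toMonoidHom)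

theorem StableGL.map_ofUnits (f : R →+* S) (v : Rˣ) :
    StableGL.map f (StableGL.ofUnits R v) = StableGL.ofUnits S (Units.map (f : R →* S) v) := by
  change StableGL.of S 1 _ = StableGL.of S 1 _
  congr 1
  ext i j
  fin_cases i; fin_cases j
  simp [GLn.map]

end Stable

/-! ### `K₁` and `K₁`-regularity -/

section KOne

variable (R : Type u) [Ring R] {S : Type u} [Ring S]

/-- `K₁(R) = GL(R)ᵃᵇ`. -/
abbrev K1 : Type u := Abelianization (StableGL R)

variable {R} in
/-- The map `K₁(R) → K₁(S)` induced by a ring homomorphism. -/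
def K1.map (f : R →+* S) : K1 R →* K1 S := Abelianization.map (StableGL.map f)

/-- The ring `R[t₁, …, tₘ]` of polynomials in `m` commuting variables that also commute with the
coefficients (`MvPolynomial` is only available for commutative `R`). -/
abbrev PolyRing (m : ℕ) : Type u := AddMonoidAlgebra R (Fin m →₀ ℕ)

/-- `R` is `K₁`-regular if the canonical map `K₁(R) → K₁(R[t₁, …, tₘ])` is an isomorphism for
every `m`. -/
def IsK1Regular : Prop :=
  ∀ m : ℕ, Function.Bijective
    (K1.map (AddMonoidAlgebra.singleZeroRingHom : R →+* PolyRing R m))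

end KOne

/-! ### Polynomially connected components -/

section Components

variable (R : Type u) [Ring R]

/-- Evaluation at `0`, as a ring homomorphism `R[t] → R`. -/
def evalZero : Polynomial R →+* R :=
  Polynomial.eval₂RingHom' (RingHom.id R) 0 fun a => Commute.zero_right a

/-- Evaluation at `1`, as a ring homomorphism `R[t] → R`. -/
def evalOne : Polynomial R →+* R :=
  Polynomial.eval₂RingHom' (RingHom.id R) 1 fun a => Commute.one_right a

theorem evalOne_C (a : R) : evalOne R (Polynomial.C a) = a := by
  simp [evalOne, Polynomial.eval₂RingHom']

/-- `U(R)⁰`: the units `g` for which there is a unit `w(t)` of `R[t]` with `w(0) = 1`, `w(1) = g`. -/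
def unitsComponent : Subgroup Rˣ :=
  (Units.map (evalZero R : Polynomial R →* R)).ker.map (Units.map (evalOne R : Polynomial R →* R))

/-- `GL(R)⁰`: the `g ∈ GL(R)` for which there is `w(t) ∈ GL(R[t])` with `w(0) = 1`, `w(1) = g`. -/
def stableGLComponent : Subgroup (StableGL R) :=
  (StableGL.map (evalZero R)).ker.map (StableGL.map (evalOne R))

theorem mem_unitsComponent {g : Rˣ} : g ∈ unitsComponent R ↔
    ∃ w : (Polynomial R)ˣ, Units.map (evalZero R : Polynomial R →* R) w = 1 ∧
      Units.map (evalOne R : Polynomial R →* R) w = g := by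
  simp [unitsComponent, Subgroup.mem_map, MonoidHom.mem_ker]

theorem mem_stableGLComponent {g : StableGL R} : g ∈ stableGLComponent R ↔
    ∃ w : StableGL (Polynomial R), StableGL.map (evalZero R) w = 1 ∧ StableGL.map (evalOne R) w = g := by
  simp [stableGLComponent, Subgroup.mem_map, MonoidHom.mem_ker]

instance unitsComponent_normal : (unitsComponent R).Normal := by
  refine Subgroup.Normal.map inferInstance _ fun g => ?_
  refine ⟨Units.map (Polynomial.C : R →+* Polynomial R) g, ?_⟩
  ext
  simp [evalOne_C]

instance stableGLComponent_normal : (stableGLComponent R).Normal := by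
  refine Subgroup.Normal.map inferInstance _ ?_
  refine DirectLimit.induction _ fun n A => ?_
  refine ⟨StableGL.of _ n (GLn.map Polynomial.C n A), ?_⟩
  rw [StableGL.map_of]
  change StableGL.of R n _ = StableGL.of R n A
  congr 1
  ext i j
  simp [GLn.map, evalOne_C]

/-- `π₀(U(R)) = U(R) / U(R)⁰`, the group of polynomially connected components of `U(R)`. -/
abbrev PiZeroUnits : Type u := Rˣ ⧸ unitsComponent R

/-- The Karoubi-Villamayor group `KV₁(R) = π₀(GL(R)) = GL(R) / GL(R)⁰`. -/
abbrev KV1 : Type u := StableGL R ⧸ stableGLComponent R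

theorem unitsComponent_le_comap :
    unitsComponent R ≤ (stableGLComponent R).comap (StableGL.ofUnits R) := by
  intro g hg
  obtain ⟨w, hw0, hw1⟩ := (mem_unitsComponent R).1 hg
  refine Subgroup.mem_comap.2 ((mem_stableGLComponent R).2 ⟨StableGL.ofUnits _ w, ?_, ?_⟩)
  · rw [StableGL.map_ofUnits, hw0, map_one]
  · rw [StableGL.map_ofUnits, hw1]

/-- The canonical homomorphism `π₀(U(R)) → KV₁(R)` induced by `U(R) → GL(R)`. -/
def piZeroUnitsToKV1 : PiZeroUnits R →* KV1 R :=
  QuotientGroup.map _ _ (StableGL.ofUnits R) (unitsComponent_le_comap R)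

end Components

end UnitalRing

end

/-! The engine is a Whitehead-type swap: if `a² = b² = 0` and `1 + ab` is a unit, then `1 + ba` is
one too, and the two agree modulo square-zero unipotents (`exists_one_add_mul_swap`). A unipotent `1
+ n` lies on the path `1 + n t`, so it dies in both π₀(U(R)) and KV₁(R). Placing rectangular `a`,
`b` in disjoint blocks makes them square-zero, so in KV₁ one always has [1 + ab] = [1 + ba]
(`mk_of_one_add_mul_comm`); in particular KV₁ is abelian.

Pure infiniteness supplies isometries `s i`, with left inverses `t i`, having mutually orthogonal
ranges. As a row and a column with `t s = 1` they compress GL_n(R) into U(R) by `g ↦ 1 + s (g - 1)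
t`, which preserves the class in KV₁. This gives surjectivity.

For injectivity a path in GL_n(R[t]) from 1 to diag(v, 1, …, 1) is compressed to a path of units,
ending at `1 + s₀ (v - 1) t₀`. Comparing this endpoint with `v` inside U(R) itself requires room:
modulo unipotents every unit fixes some nonzero idempotent `f` (`exists_unit_fixing_idempotent`),
and with isometries chosen below `f` the swap applies without enlarging matrices.

For part (2), K₁-regularity makes the two evaluations K₁(R[t]) → K₁(R) coincide, so K₁(R) → KV₁(R)
is an isomorphism, and it is composed with the inverse of (1). -/

noncomputable section

namespace UnitalRing

universe u

open scoped Pointwise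

/-! ### Square-zero unipotents -/

section Unipotent

variable {A : Type u} [Ring A]

/-- The unit `1 + n`, for `n` of square zero. -/
def unipotent (n : A) (hn : n * n = 0) : Aˣ where
  val := 1 + n
  inv := 1 - n
  val_inv := by linear_combination (norm := noncomm_ring) -hn
  inv_val := by linear_combination (norm := noncomm_ring) -hn

/-- If `a² = b² = 0` and `1 + ab` is a unit, then `1 + ba` is a unit, and the two agree modulo any
normal subgroup which contains all square-zero unipotents. -/
theorem exists_one_add_mul_swap (N : Subgroup Aˣ) [N.Normal]
    (hN : ∀ (n : A) (hn : n * n = 0), unipotent n hn ∈ N) {a b : A} (ha : a * a = 0)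
    (hb : b * b = 0) (g : Aˣ) (hg : (g : A) = 1 + a * b) :
    ∃ h : Aˣ, (h : A) = 1 + b * a ∧ (QuotientGroup.mk h : Aˣ ⧸ N) = QuotientGroup.mk g := by
  have hb' : -b * -b = 0 := by simpa using hb
  -- Since `a² = b² = 0`, both `(1 + a)(1 + ab)(1 - b)` and `(1 - b)(1 + ba)(1 + a)` equal `1 + a -
  -- b`; solving for `1 + ba` gives this unit.
  refine ⟨(unipotent (-b) hb')⁻¹ * unipotent a ha * g * unipotent (-b) hb' * (unipotent a ha)⁻¹,
    ?_, ?_⟩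
  · have key : (unipotent a ha : A) * g * unipotent (-b) hb' =
        unipotent (-b) hb' * (1 + b * a) * unipotent a ha := by
      simp only [unipotent, hg]
      linear_combination (norm := noncomm_ring)
        ha * (b - b * b) - a * hb + hb * a - b * ha + hb * (a * a)
    have e : ∀ x y : Aˣ, ((x⁻¹ * unipotent a ha * g * x * y⁻¹ : Aˣ) : A) =
        ↑x⁻¹ * ((unipotent a ha : A) * g * x) * ↑y⁻¹ := fun x y => by
      simp [mul_assoc]
    rw [e, key]
    simp [mul_assoc]
  · have h1 := (QuotientGroup.eq_one_iff (N := N) _).2 (hN _ ha)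
    have h2 := (QuotientGroup.eq_one_iff (N := N) _).2 (hN _ hb')
    simp [h1, h2]

end Unipotent

/-! ### Idempotents in purely infinite simple rings -/

section PurelyInfinite

variable {R : Type u} [Ring R]

/-- By simplicity `1 = ∑ cᵢ r dᵢ`. The infinite idempotent contains orthogonal copies `yⁱ r xⁱ` of
`r`, that is, `r xⁱ yʲ r = δᵢⱼ r`, so `a = ∑ cᵢ r xⁱ` and `b = ∑ yⁱ r dᵢ` satisfy `a p b = 1`. -/
theorem exists_mul_mul_eq_one_of_isInfiniteIdempotent (hR : IsSimpleRing R) {p : R}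
    (hp : IsInfiniteIdempotent p) : ∃ a b : R, a * p * b = 1 := by
  obtain ⟨hpp, q, r, hq, hr, hqr, hrq, rfl, ⟨x, y, hx, hy, hxy, hyx⟩, hr0⟩ := hp
  have hq' : q * q = q := hq
  have hr' : r * r = r := hr
  have hpx : (q + r) * x = x := by rw [← hx]; simp only [← mul_assoc, hpp.eq]
  have hxq : x * q = x := by rw [← hx]; simp only [mul_assoc, hq']
  have hqy : q * y = y := by rw [← hy]; simp only [← mul_assoc, hq']
  have hyp : y * (q + r) = y := by rw [← hy]; simp only [mul_assoc, hpp.eq]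
  have hxr : x * r = 0 := by rw [← hxq, mul_assoc, hqr, mul_zero]
  have hry : r * y = 0 := by rw [← hqy, ← mul_assoc, hrq, zero_mul]
  have hxyy : x * y * y = y := by rw [hxy, add_mul, hqy, hry, add_zero]
  have hxxy : x * (x * y) = x := by rw [hxy, mul_add, hxq, hxr, add_zero]
  have hxyr : x * y * r = r := by rw [hxy, add_mul, hqr, hr', zero_add]
  have e1 : ∀ k : ℕ, x ^ k * y ^ (k + 1) = y := by
    intro k
    induction k with
    | zero => simp
    | succ k ih => rw [pow_succ', pow_succ y, mul_assoc, ← mul_assoc (x ^ k), ih, ← mul_assoc, hxyy]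
  have e2 : ∀ k : ℕ, x ^ (k + 1) * y ^ k = x := by
    intro k
    induction k with
    | zero => simp
    | succ k ih =>
      rw [pow_succ', pow_succ y, mul_assoc, ← mul_assoc (x ^ (k + 1)), ih, hxxy]
  have e3 : ∀ k : ℕ, x ^ k * y ^ k * r = r := by
    intro k
    induction k with
    | zero => simp
    | succ k ih => rw [pow_succ y, ← mul_assoc, e2, hxyr]
  -- `z` factors through `p` using only the first `k` copies of `r`: the conditions `a yᵏ = 0` and
  -- `xᵏ b = 0` kill the cross terms when the next copy `yᵏ r xᵏ` is used to add a term `c r d`.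
  let P : R → Prop := fun z => ∃ (k : ℕ) (a b : R), a * (q + r) = a ∧ a * b = z ∧
    a * y ^ k = 0 ∧ x ^ k * b = 0
  have hP : ∀ z c d, P z → P (z + c * r * d) := by
    rintro z c d ⟨k, a, b, h1, h2, h3, h4⟩
    have hrp : r * x ^ k * (q + r) = r * x ^ k := by
      cases k with
      | zero => simp [mul_add, hrq, hr']
      | succ k => rw [pow_succ, mul_assoc, mul_assoc, mul_add x, hxq, hxr, add_zero]
    refine ⟨k + 1, a + c * (r * x ^ k), b + y ^ k * r * d, ?_, ?_, ?_, ?_⟩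
    · rw [add_mul, h1, mul_assoc c, hrp]
    · have : (a + c * (r * x ^ k)) * (b + y ^ k * r * d) = a * b + a * y ^ k * (r * d)
          + c * r * (x ^ k * b) + c * r * (x ^ k * y ^ k * r) * d := by noncomm_ring
      rw [this, h2, h3, h4, e3, mul_assoc c r r, hr']
      simp
    · rw [add_mul, mul_assoc c, mul_assoc r, e1, hry, pow_succ, ← mul_assoc, h3]
      simp
    · rw [mul_add, pow_succ' , mul_assoc x, h4, ← pow_succ', ← mul_assoc, ← mul_assoc, e2, hxr]
      simp
  have h1 : (1 : R) ∈ TwoSidedIdeal.span {r} :=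
    IsSimpleRing.one_mem_of_ne_zero_mem _ hr0 (TwoSidedIdeal.subset_span rfl)
  rw [TwoSidedIdeal.mem_span_iff_mem_addSubgroup_closure] at h1
  -- Both signs are carried along so that the induction on the additive closure of `R r R` passes
  -- through negatives.
  have hQ : ∀ w ∈ AddSubgroup.closure ((Set.univ : Set R) * ({r} : Set R) * (Set.univ : Set R)),
      (∀ z, P z → P (z + w)) ∧ (∀ z, P z → P (z - w)) := by
    intro w hw
    induction hw using AddSubgroup.closure_induction with
    | mem w hw =>
      obtain ⟨_, ⟨c, -, _, rfl, rfl⟩, d, -, rfl⟩ := hw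
      refine ⟨fun z hz => hP z c d hz, fun z hz => ?_⟩
      simpa [sub_eq_add_neg] using hP z (-c) d hz
    | zero => simp
    | add v w _ _ hv hw =>
      refine ⟨fun z hz => ?_, fun z hz => ?_⟩
      · rw [← add_assoc]; exact hw.1 _ (hv.1 _ hz)
      · rw [← sub_sub]; exact hw.2 _ (hv.2 _ hz)
    | neg v _ hv => simpa [sub_eq_add_neg, and_comm] using hv
  obtain ⟨k, a, b, h2, h3, -⟩ := (hQ 1 h1).1 0 ⟨0, 0, 0, by simp⟩
  exact ⟨a, b, by rw [h2, h3, zero_add]⟩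

theorem IsPurelyInfiniteSimple.nontrivial (hR : IsPurelyInfiniteSimple R) : Nontrivial R := by
  have := hR.simple
  infer_instance

theorem IsPurelyInfiniteSimple.exists_mul_mul_eq_one (hR : IsPurelyInfiniteSimple R) {x : R}
    (hx : x ≠ 0) : ∃ s t : R, s * x * t = 1 := by
  obtain ⟨s, t, h⟩ := hR.exists_infinite x hx
  obtain ⟨a, b, hab⟩ := exists_mul_mul_eq_one_of_isInfiniteIdempotent hR.simple h
  exact ⟨a * s, t * b, by rw [← hab]; simp only [mul_assoc]⟩

/-- The ring `R` contains two isometries with orthogonal ranges. -/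
theorem IsPurelyInfiniteSimple.exists_two_isometries (hR : IsPurelyInfiniteSimple R) :
    ∃ s₀ s₁ t₀ t₁ : R, t₀ * s₀ = 1 ∧ t₁ * s₁ = 1 ∧ t₀ * s₁ = 0 ∧ t₁ * s₀ = 0 := by
  have := hR.nontrivial
  obtain ⟨s, t, hp⟩ := hR.exists_infinite 1 one_ne_zero
  obtain ⟨a', b', hab'⟩ := exists_mul_mul_eq_one_of_isInfiniteIdempotent hR.simple hp
  obtain ⟨hpp, q, r, hq, hr, hqr, hrq, hpqr, ⟨x, y, hx, hy, hxy, hyx⟩, hr0⟩ := hp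
  obtain ⟨a, b, hab⟩ := hR.exists_mul_mul_eq_one hr0
  have hxr : x * r = 0 := by rw [← hx, mul_assoc, hqr, mul_zero]
  have hry : r * y = 0 := by rw [← hy, mul_assoc q, ← mul_assoc r, hrq, zero_mul]
  -- One isometry has its range under `r`, from `a r b = 1`; the other under `q`, from `a' p b' = 1`
  -- and `p = x y`. Orthogonality of `q` and `r` separates them.
  refine ⟨r * b, y * b', a * r, a' * x, ?_, ?_, ?_, ?_⟩
  · rw [mul_assoc, ← mul_assoc r r, hr.eq, ← mul_assoc, hab]
  · rw [mul_assoc, ← mul_assoc x, hxy, ← mul_assoc, hab']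
  · rw [mul_assoc, ← mul_assoc r, hry, zero_mul, mul_zero]
  · rw [mul_assoc, ← mul_assoc x, hxr, zero_mul, mul_zero]

/-- The ring `R` contains infinitely many isometries with orthogonal ranges. -/
theorem IsPurelyInfiniteSimple.exists_isometries (hR : IsPurelyInfiniteSimple R) :
    ∃ s t : ℕ → R, ∀ i j, t i * s j = if i = j then 1 else 0 := by
  obtain ⟨s₀, s₁, t₀, t₁, h00, h11, h01, h10⟩ := hR.exists_two_isometries
  have h : ∀ k, t₁ ^ k * s₁ ^ k = 1 := by
    intro k
    induction k with
    | zero => simp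
    | succ k ih => rw [pow_succ, pow_succ', mul_assoc, ← mul_assoc t₁, h11, one_mul, ih]
  -- The words `s₁ⁱ s₀`: two different ones first disagree at a letter `s₀` against `s₁`, where `t₀
  -- s₁ = 0` or `t₁ s₀ = 0` applies.
  refine ⟨fun i => s₁ ^ i * s₀, fun i => t₀ * t₁ ^ i, fun i j => ?_⟩
  have e : t₀ * t₁ ^ i * (s₁ ^ j * s₀) = t₀ * (t₁ ^ i * s₁ ^ j) * s₀ := by simp only [mul_assoc]
  dsimp only
  rw [e]
  rcases lt_trichotomy i j with hij | rfl | hij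
  · obtain ⟨k, rfl⟩ := Nat.exists_eq_add_of_lt hij
    rw [if_neg hij.ne, add_assoc, pow_add, ← mul_assoc (t₁ ^ i), h, one_mul, pow_succ',
      ← mul_assoc, h01, zero_mul, zero_mul]
  · simp [h, h00]
  · obtain ⟨k, rfl⟩ := Nat.exists_eq_add_of_lt hij
    rw [if_neg hij.ne', add_assoc, add_comm j, pow_add, mul_assoc (t₁ ^ (k + 1)), h, mul_one,
      pow_succ, mul_assoc, mul_assoc, h10, mul_zero, mul_zero]

/-- Below every nonzero idempotent `f` there are infinitely many isometries with orthogonal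
ranges. -/
theorem IsPurelyInfiniteSimple.exists_isometries_le (hR : IsPurelyInfiniteSimple R) {f : R}
    (hf : f * f = f) (hf0 : f ≠ 0) :
    ∃ s t : ℕ → R, (∀ i j, t i * s j = if i = j then 1 else 0) ∧ (∀ i, f * s i = s i) ∧
      ∀ i, t i * f = t i := by
  obtain ⟨s, t, h⟩ := hR.exists_isometries
  obtain ⟨a, b, hab⟩ := hR.exists_mul_mul_eq_one hf0
  refine ⟨fun i => f * b * s i, fun i => t i * (a * f), fun i j => ?_, fun i => ?_, fun i => ?_⟩
  · have : t i * (a * f) * (f * b * s j) = t i * (a * (f * f) * b) * s j := by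
      simp only [mul_assoc]
    dsimp only
    rw [this, hf, hab, mul_one, h]
  · simp only [← mul_assoc, hf]
  · simp only [mul_assoc, hf]

/-- Modulo any subgroup which contains all square-zero unipotents, every unit of `R` agrees with a
unit of the form `f + (1 - f) v (1 - f)`, for a nonzero idempotent `f`. -/
theorem IsPurelyInfiniteSimple.exists_unit_fixing_idempotent (hR : IsPurelyInfiniteSimple R)
    (N : Subgroup Rˣ) [N.Normal] (hN : ∀ (n : R) (hn : n * n = 0), unipotent n hn ∈ N) (u : Rˣ) :
    ∃ (v : Rˣ) (f : R), (QuotientGroup.mk v : Rˣ ⧸ N) = QuotientGroup.mk u ∧ f * f = f ∧ f ≠ 0 ∧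
      (v : R) * f = f ∧ f * v = f := by
  have := hR.nontrivial
  have hN' : ∀ (n : R) (hn : n * n = 0), (QuotientGroup.mk (unipotent n hn) : Rˣ ⧸ N) = 1 :=
    fun n hn => (QuotientGroup.eq_one_iff _).2 (hN n hn)
  obtain ⟨s₀, s₁, t₀, t₁, h00, h11, h01, h10⟩ := hR.exists_two_isometries
  let e := s₀ * t₀
  have he : e * e = e := by
    change s₀ * t₀ * (s₀ * t₀) = s₀ * t₀
    rw [mul_assoc, ← mul_assoc t₀, h00, one_mul]
  -- make an off-diagonal corner nonzero
  obtain ⟨v, hvu, hv⟩ : ∃ v : Rˣ, (QuotientGroup.mk v : Rˣ ⧸ N) = QuotientGroup.mk u ∧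
      e * v * (1 - e) ≠ 0 := by
    by_cases hb : e * u * (1 - e) = 0
    -- If the corner vanishes then `e u e = e u`, so right multiplication by `1 + e u⁻¹ x`, with `0
    -- ≠ x ∈ e R (1 - e)`, changes the corner from `0` to `e u u⁻¹ x = x`.
    · let x := s₀ * t₁
      have hex : e * x = x := by
        change s₀ * t₀ * (s₀ * t₁) = s₀ * t₁
        rw [mul_assoc, ← mul_assoc t₀, h00, one_mul]
      have hxe : x * e = 0 := by
        change s₀ * t₁ * (s₀ * t₀) = 0
        rw [mul_assoc, ← mul_assoc t₁, h10, zero_mul, mul_zero]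
      have hx : x ≠ 0 := fun h => by
        have : t₀ * x * s₁ = 1 := by
          change t₀ * (s₀ * t₁) * s₁ = 1
          rw [← mul_assoc, h00, one_mul, h11]
        rw [h] at this
        simp at this
      have hn : e * ↑u⁻¹ * x * (e * ↑u⁻¹ * x) = 0 := by
        have : e * ↑u⁻¹ * x * (e * ↑u⁻¹ * x) = e * ↑u⁻¹ * (x * e) * ↑u⁻¹ * x := by
          simp only [mul_assoc]
        rw [this, hxe]; simp
      refine ⟨u * unipotent _ hn, by simp [hN' _ hn], ?_⟩
      have h1 : e * (u : R) * e = e * u := by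
        linear_combination (norm := noncomm_ring) -hb
      have h2 : e * (u : R) * (e * ↑u⁻¹ * x) = x := by
        have : e * (u : R) * (e * ↑u⁻¹ * x) = e * u * e * ↑u⁻¹ * x := by simp only [mul_assoc]
        rw [this, h1, mul_assoc e, Units.mul_inv, mul_one, hex]
      have : e * ((u * unipotent _ hn : Rˣ) : R) * (1 - e) = x := by
        simp only [Units.val_mul, unipotent]
        linear_combination (norm := noncomm_ring) hb + h2 * (1 - e) - hxe
      rwa [this]
    · exact ⟨u, rfl, hb⟩
  obtain ⟨s, t, hst⟩ := hR.exists_mul_mul_eq_one hv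
  -- make a diagonal corner equal to an idempotent
  let b := e * v * (1 - e)
  -- An idempotent below `e`, because `s b t = 1` and `e b = b`; it factors through the off-diagonal
  -- corner `b`, which is what allows the next correction.
  let f := b * t * s * e
  have hsb : s * b * t = 1 := hst
  have heb : e * b = b := by simp only [b, ← mul_assoc, he]
  have hef : e * f = f := by simp only [f, ← mul_assoc, heb]
  have hfe : f * e = f := by simp only [f, mul_assoc, he]
  have hff : f * f = f := by
    have : f * f = b * t * (s * (e * b) * t) * s * e := by simp only [f, mul_assoc]
    rw [this, heb, hsb, mul_one]
  have hf0 : f ≠ 0 := fun h => by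
    have h1 : s * f * (b * t) = (s * b * t) * (s * (e * b) * t) := by simp only [f, mul_assoc]
    rw [heb, hsb, h] at h1
    simp at h1
  -- Chosen to solve `f v y = f - f v f`: moving through `1 - e` makes `v` contribute its corner
  -- `b`, and `b t s e = f`. Since `y` maps into `1 - e` and `y e = y`, it squares to zero, and `f v
  -- (1 + y) f = f`.
  let y := (1 - e) * t * s * e * (f - f * v * f)
  have hfy : y * f = y := by
    simp only [y]
    linear_combination (norm := noncomm_ring) (1 - e) * t * s * e * (1 - f * v) * hff
  have hye : y * e = y := by rw [← hfy, mul_assoc, hfe]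
  have hey : e * y = 0 := by
    simp only [y]
    linear_combination (norm := noncomm_ring) -he * t * s * e * (f - f * v * f)
  have hyy : y * y = 0 := by
    have : y * y = y * e * y := by rw [hye]
    rw [this, mul_assoc, hey, mul_zero]
  have hfvy : f * v * y = f - f * v * f := by
    have h1 : f * v * (1 - e) = f * b := by
      simp only [b, ← mul_assoc, hfe]
    have h2 : f * v * y = f * v * (1 - e) * (t * s * e * (f - f * v * f)) := by
      simp only [y, mul_assoc]
    have h3 : f * b * (t * s * e * (f - f * v * f)) = f * f * (f - f * v * f) := by
      simp only [f, mul_assoc]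
    rw [h2, h1, h3, hff]
    linear_combination (norm := noncomm_ring) hff - hff * v * f
  obtain ⟨w, hwu, hw⟩ : ∃ w : Rˣ, (QuotientGroup.mk w : Rˣ ⧸ N) = QuotientGroup.mk u ∧
      f * w * f = f := by
    refine ⟨v * unipotent y hyy, by simp [hvu, hN'], ?_⟩
    simp only [Units.val_mul, unipotent]
    linear_combination (norm := noncomm_ring) hfvy + f * v * hfy
  -- clear the row and the column of `f`
  have ha : -((1 - f) * w * f) * -((1 - f) * w * f) = 0 := by
    linear_combination (norm := noncomm_ring) -(1 - f) * w * hff * w * f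
  have hc : -(f * w * (1 - f)) * -(f * w * (1 - f)) = 0 := by
    linear_combination (norm := noncomm_ring) -f * w * hff * w * (1 - f)
  refine ⟨unipotent _ ha * w * unipotent _ hc, f, by simp [hN', hwu], hff, hf0, ?_, ?_⟩
  · simp only [Units.val_mul, unipotent]
    linear_combination (norm := noncomm_ring)
      (w - (1 - f) * w * f * w) * f * w * hff - (1 - f) * w * hw + hw
  · simp only [Units.val_mul, unipotent]
    linear_combination (norm := noncomm_ring)
      hff * w * f * w * (1 - f * w * (1 - f)) - hw * w * (1 - f) + hw

end PurelyInfinite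

/-! ### Unipotents are connected to the identity -/

section Connected

variable (R : Type u) [Ring R]

@[simp]
theorem evalZero_C (a : R) : evalZero R (Polynomial.C a) = a := by
  simp [evalZero, Polynomial.eval₂RingHom']

@[simp]
theorem evalZero_X : evalZero R Polynomial.X = 0 := by
  simp [evalZero, Polynomial.eval₂RingHom']

@[simp]
theorem evalOne_X : evalOne R Polynomial.X = 1 := by
  simp [evalOne, Polynomial.eval₂RingHom']

/-- The path is `1 + n t`, itself a square-zero unipotent over `R[t]` because `t` is central. -/
theorem unipotent_mem_unitsComponent (n : R) (hn : n * n = 0) :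
    unipotent n hn ∈ unitsComponent R := by
  have h : Polynomial.C n * Polynomial.X * (Polynomial.C n * Polynomial.X) = 0 := by
    rw [mul_assoc, ← mul_assoc Polynomial.X, Polynomial.X_mul_C, mul_assoc (Polynomial.C n),
      ← mul_assoc (Polynomial.C n), ← Polynomial.C_mul, hn]
    simp
  refine (mem_unitsComponent R).2 ⟨unipotent _ h, ?_, ?_⟩ <;> ext <;>
    simp [unipotent, evalOne_C]

theorem of_unipotent_mem_stableGLComponent (k : ℕ) (n : Matrix (Fin k) (Fin k) R)
    (hn : n * n = 0) : StableGL.of R k (unipotent n hn) ∈ stableGLComponent R := by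
  let x : Matrix (Fin k) (Fin k) (Polynomial R) := Matrix.scalar (Fin k) Polynomial.X
  let c : Matrix (Fin k) (Fin k) (Polynomial R) := Polynomial.C.mapMatrix n
  have hx : x * c = c * x :=
    (Matrix.scalar_commute Polynomial.X (fun r => Polynomial.commute_X r) c).eq
  have h : c * x * (c * x) = 0 := by
    rw [mul_assoc, ← mul_assoc x, hx, mul_assoc c, ← mul_assoc c, ← map_mul, hn]
    simp
  refine (mem_stableGLComponent R).2 ⟨StableGL.of _ k (unipotent _ h), ?_, ?_⟩
  · rw [StableGL.map_of, ← map_one (StableGL.of R k)]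
    congr 1
    ext i j
    by_cases hij : i = j <;> simp [unipotent, GLn.map, x, c, hij]
  · rw [StableGL.map_of]
    congr 1
    ext i j
    simp [unipotent, GLn.map, x, c, Matrix.one_apply, apply_ite, evalOne_C]

end Connected

/-! ### Whitehead's lemma for `KV₁` -/

section Whitehead

variable {R : Type u} [Ring R]

/-- Puts stabilization in the form `1 + (block)`, with the block inserted by rectangular pieces of
the identity, so that the swap can move it between disjoint positions. -/
theorem stabMatrix_eq {m n : ℕ} (h : m ≤ n) (A : Matrix (Fin m) (Fin m) R) :
    (stabMatrix A : Matrix (Fin n) (Fin n) R) =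
      1 + (1 : Matrix (Fin n) (Fin n) R).submatrix id (Fin.castLE h) * (A - 1) *
        (1 : Matrix (Fin n) (Fin n) R).submatrix (Fin.castLE h) id := by
  ext i j
  have key : ∀ M : Matrix (Fin m) (Fin m) R,
      ((1 : Matrix (Fin n) (Fin n) R).submatrix id (Fin.castLE h) * M *
        (1 : Matrix (Fin n) (Fin n) R).submatrix (Fin.castLE h) id) i j =
      if h : (i : ℕ) < m ∧ (j : ℕ) < m then M ⟨i, h.1⟩ ⟨j, h.2⟩ else 0 := by
    intro M
    simp only [Matrix.mul_apply, Matrix.submatrix_apply, id, Matrix.one_apply, ite_mul, one_mul,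
      zero_mul, mul_ite, mul_one, mul_zero]
    split_ifs with hij
    · rw [Finset.sum_eq_single ⟨j, hij.2⟩, if_pos (by ext; simp), Finset.sum_eq_single ⟨i, hij.1⟩,
        if_pos (by ext; simp)]
      · intro b _ hb
        exact if_neg fun h => hb (by ext; simp [h])
      · simp
      · intro b _ hb
        exact if_neg fun h => hb (by ext; simp [← h])
      · simp
    · refine Finset.sum_eq_zero fun b _ => ?_
      split_ifs with hb
      · refine Finset.sum_eq_zero fun a _ => if_neg fun ha => hij ?_
        subst ha hb
        simp
      · rfl
  rw [Matrix.add_apply, key]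
  simp only [stabMatrix]
  split_ifs with h1 h2 <;> simp_all [Matrix.one_apply, Fin.ext_iff]

theorem submatrix_one_mul_self {n k : ℕ} {i : Fin n → Fin k} (hi : Function.Injective i) :
    (1 : Matrix (Fin k) (Fin k) R).submatrix i id * (1 : Matrix (Fin k) (Fin k) R).submatrix id i
      = 1 := by
  rw [← Matrix.submatrix_mul _ _ _ _ _ Function.bijective_id, one_mul, Matrix.submatrix_one _ hi]

theorem submatrix_one_mul_of_ne {m n k : ℕ} {i : Fin m → Fin k} {j : Fin n → Fin k}
    (hij : ∀ a b, i a ≠ j b) :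
    (1 : Matrix (Fin k) (Fin k) R).submatrix i id * (1 : Matrix (Fin k) (Fin k) R).submatrix id j
      = 0 := by
  rw [← Matrix.submatrix_mul _ _ _ _ _ Function.bijective_id, one_mul]
  ext a b
  simp [hij a b]

/-- Units `1 + ab` and `1 + ba`, placed in disjoint blocks of a larger matrix, agree in `KV₁`. -/
theorem exists_mk_of_block_swap {m n k : ℕ} {i : Fin m → Fin k} {j : Fin n → Fin k}
    (hi : Function.Injective i) (hj : Function.Injective j) (hij : ∀ a b, i a ≠ j b)
    (a : Matrix (Fin m) (Fin n) R) (b : Matrix (Fin n) (Fin m) R) (g : GLn R k)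
    (hg : (g : Matrix (Fin k) (Fin k) R) = 1 + (1 : Matrix (Fin k) (Fin k) R).submatrix id i *
      (a * b) * (1 : Matrix (Fin k) (Fin k) R).submatrix i id) :
    ∃ h : GLn R k, (h : Matrix (Fin k) (Fin k) R) = 1 +
      (1 : Matrix (Fin k) (Fin k) R).submatrix id j * (b * a) *
        (1 : Matrix (Fin k) (Fin k) R).submatrix j id ∧
      (QuotientGroup.mk (StableGL.of R k h) : KV1 R) = QuotientGroup.mk (StableGL.of R k g) := by
  set P := (1 : Matrix (Fin k) (Fin k) R).submatrix id i
  set P' := (1 : Matrix (Fin k) (Fin k) R).submatrix i id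
  set Q := (1 : Matrix (Fin k) (Fin k) R).submatrix id j
  set Q' := (1 : Matrix (Fin k) (Fin k) R).submatrix j id
  have hP : P' * P = 1 := submatrix_one_mul_self hi
  have hQ : Q' * Q = 1 := submatrix_one_mul_self hj
  have hPQ : P' * Q = 0 := submatrix_one_mul_of_ne hij
  have hQP : Q' * P = 0 := submatrix_one_mul_of_ne fun x y => (hij y x).symm
  -- Disjointness of the two blocks makes `P a Q'` and `Q b P'` square-zero; their products in the
  -- two orders are the two blocks to be swapped.
  have h1 : P * a * Q' * (P * a * Q') = 0 := by
    rw [Matrix.mul_assoc P a Q', ← Matrix.mul_assoc P a Q', Matrix.mul_assoc (P * a),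
      ← Matrix.mul_assoc Q', ← Matrix.mul_assoc Q', hQP]
    simp
  have h2 : Q * b * P' * (Q * b * P') = 0 := by
    rw [Matrix.mul_assoc (Q * b), ← Matrix.mul_assoc P', ← Matrix.mul_assoc P', hPQ]
    simp
  have h3 : P * a * Q' * (Q * b * P') = P * (a * b) * P' := by
    rw [Matrix.mul_assoc (P * a), ← Matrix.mul_assoc Q', ← Matrix.mul_assoc Q', hQ,
      Matrix.one_mul]
    simp only [Matrix.mul_assoc]
  have h4 : Q * b * P' * (P * a * Q') = Q * (b * a) * Q' := by
    rw [Matrix.mul_assoc (Q * b), ← Matrix.mul_assoc P', ← Matrix.mul_assoc P', hP,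
      Matrix.one_mul]
    simp only [Matrix.mul_assoc]
  have : ((stableGLComponent R).comap (StableGL.of R k)).Normal := inferInstance
  obtain ⟨h, hh, hhg⟩ := exists_one_add_mul_swap ((stableGLComponent R).comap (StableGL.of R k))
    (fun n hn => of_unipotent_mem_stableGLComponent R k n hn) h1 h2 g (by rw [hg, h3])
  refine ⟨h, by rw [hh, h4], ?_⟩
  rw [QuotientGroup.eq] at hhg ⊢
  simpa using hhg

theorem StableGL.of_stab {m n : ℕ} (h : m ≤ n) (g : GLn R m) :
    StableGL.of R n (GLn.stab R m n h g) = StableGL.of R m g :=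
  DirectLimit.eq_of_le (f := GLn.stab R) ⟨m, g⟩ n h |>.symm

/-- For rectangular matrices `a` and `b`, the units `1 + ab` and `1 + ba` agree in `KV₁`. -/
theorem mk_of_one_add_mul_comm {m n : ℕ} (a : Matrix (Fin m) (Fin n) R)
    (b : Matrix (Fin n) (Fin m) R) (g : GLn R m) (h : GLn R n)
    (hg : (g : Matrix (Fin m) (Fin m) R) = 1 + a * b)
    (hh : (h : Matrix (Fin n) (Fin n) R) = 1 + b * a) :
    (QuotientGroup.mk (StableGL.of R m g) : KV1 R) = QuotientGroup.mk (StableGL.of R n h) := by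
  -- The two upper-left blocks overlap, so the swap goes through the last `n` coordinates, disjoint
  -- from both: first from `ab` to `ba`, then back up with the factors `ba` and `1`.
  have hm : m ≤ m + n + n := by omega
  have hn : n ≤ m + n + n := by omega
  let j : Fin n → Fin (m + n + n) := Fin.natAdd (m + n)
  have hj : Function.Injective j := Fin.natAdd_injective n (m + n)
  obtain ⟨g', hg', hgg'⟩ := exists_mk_of_block_swap (i := Fin.castLE hm) (j := j)
    (Fin.castLE_injective hm) hj
    (fun x y hxy => by have := congrArg Fin.val hxy; simp [j] at this; omega) a b
    (GLn.stab R m _ hm g) ((stabMatrix_eq hm _).trans (by rw [hg, add_sub_cancel_left]))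
  obtain ⟨h', hh', hhh'⟩ := exists_mk_of_block_swap (i := j) (j := Fin.castLE hn) hj
    (Fin.castLE_injective hn)
    (fun x y hxy => by have := congrArg Fin.val hxy; simp [j] at this; omega) (b * a) 1
    g' (by rw [hg', Matrix.mul_one])
  have : h' = GLn.stab R n _ hn h := by
    ext1
    refine hh'.trans (Eq.symm ((stabMatrix_eq hn _).trans ?_))
    rw [hh, add_sub_cancel_left, Matrix.one_mul]
  rw [← StableGL.of_stab hm g, ← StableGL.of_stab hn h, ← this, hhh', hgg']

/-- Commutativity is a swap: `gh = 1 + (g - h⁻¹) h` and `hg = 1 + h (g - h⁻¹)`. -/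
theorem KV1.mul_comm (x y : KV1 R) : x * y = y * x := by
  induction x using QuotientGroup.induction_on with | _ x
  induction y using QuotientGroup.induction_on with | _ y
  revert x y
  refine DirectLimit.induction₂ _ fun n g h => ?_
  change (QuotientGroup.mk (StableGL.of R n g * StableGL.of R n h) : KV1 R) =
    QuotientGroup.mk (StableGL.of R n h * StableGL.of R n g)
  rw [← map_mul, ← map_mul]
  refine mk_of_one_add_mul_comm (g - ↑h⁻¹ : Matrix (Fin n) (Fin n) R) h _ _ ?_ ?_
  · simp [sub_mul]
  · simp [mul_sub]

end Whitehead

/-! ### Compressing matrices along isometries -/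

section Compress

variable {A : Type u} [Ring A] {B : Type u} [Ring B]

/-- The homomorphism `GL_n(A) → GL_1(A)`, `g ↦ 1 + s (g - 1) t`, for a row `s` and a column `t`
with `t s = 1`. -/
def compress {n : ℕ} (s : Matrix (Fin 1) (Fin n) A) (t : Matrix (Fin n) (Fin 1) A)
    (h : t * s = 1) : GLn A n →* GLn A 1 :=
  Units.map
    { toFun := fun g => 1 + s * (g - 1) * t
      map_one' := by simp
      map_mul' := fun x y => by
        have e : s * (x - 1) * t * (s * (y - 1) * t) = s * ((x - 1) * (y - 1)) * t := by
          have : s * (x - 1) * t * (s * (y - 1) * t) = s * (x - 1) * (t * s) * (y - 1) * t := by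
            simp only [Matrix.mul_assoc]
          rw [this, h, Matrix.mul_one, Matrix.mul_assoc s]
        rw [add_mul, mul_add, mul_add, e, one_mul, mul_one, one_mul, add_assoc, ← Matrix.add_mul,
          ← Matrix.mul_add, ← Matrix.add_mul, ← Matrix.mul_add]
        congr 3
        noncomm_ring }

theorem coe_compress {n : ℕ} (s : Matrix (Fin 1) (Fin n) A) (t : Matrix (Fin n) (Fin 1) A)
    (h : t * s = 1) (g : GLn A n) :
    (compress s t h g : Matrix (Fin 1) (Fin 1) A) =
      1 + s * ((g : Matrix (Fin n) (Fin n) A) - 1) * t := rfl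

theorem map_compress (f : A →+* B) {n : ℕ} (s : Matrix (Fin 1) (Fin n) A)
    (t : Matrix (Fin n) (Fin 1) A) (h : t * s = 1) (h' : t.map f * s.map f = 1) (g : GLn A n) :
    GLn.map f 1 (compress s t h g) = compress (s.map f) (t.map f) h' (GLn.map f n g) := by
  ext1
  change (1 + s * ((g : Matrix (Fin n) (Fin n) A) - 1) * t : Matrix (Fin 1) (Fin 1) A).map f =
    1 + s.map f * ((g : Matrix (Fin n) (Fin n) A).map f - 1) * t.map f
  rw [Matrix.map_add _ (map_add f), Matrix.map_mul, Matrix.map_mul, Matrix.map_sub _ (map_sub f),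
    Matrix.map_one _ (map_zero f) (map_one f), Matrix.map_one _ (map_zero f) (map_one f)]

variable (A) in
/-- The canonical isomorphism `GL_1(A) ≃ U(A)`. -/
def GLn.oneEquiv : GLn A 1 ≃* Aˣ := Units.mapEquiv (Matrix.uniqueRingEquiv (m := Fin 1)).toMulEquiv

theorem GLn.coe_oneEquiv (g : GLn A 1) :
    (GLn.oneEquiv A g : A) = (g : Matrix (Fin 1) (Fin 1) A) 0 0 := rfl

theorem StableGL.ofUnits_oneEquiv (g : GLn A 1) :
    StableGL.ofUnits A (GLn.oneEquiv A g) = StableGL.of A 1 g := by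
  change StableGL.of A 1 _ = StableGL.of A 1 _
  congr 1
  ext i j
  fin_cases i; fin_cases j
  simp [GLn.coe_oneEquiv]

theorem GLn.oneEquiv_map (f : A →+* B) (g : GLn A 1) :
    GLn.oneEquiv B (GLn.map f 1 g) = Units.map (f : A →* B) (GLn.oneEquiv A g) := rfl

/-- Swapping the factors `s (g - 1)` and `t` turns `1 + s (g - 1) t` into `1 + t s (g - 1) = g`. -/
theorem mk_of_compress {n : ℕ} (s : Matrix (Fin 1) (Fin n) A) (t : Matrix (Fin n) (Fin 1) A)
    (h : t * s = 1) (g : GLn A n) :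
    (QuotientGroup.mk (StableGL.of A 1 (compress s t h g)) : KV1 A) =
      QuotientGroup.mk (StableGL.of A n g) := by
  refine mk_of_one_add_mul_comm (s * ((g : Matrix (Fin n) (Fin n) A) - 1)) t _ _ (coe_compress s t h g) ?_
  rw [← Matrix.mul_assoc, h, Matrix.one_mul, add_sub_cancel]

/-- An element of `GL(A)` is represented by arbitrarily large matrices. -/
theorem StableGL.exists_of (k : ℕ) (x : StableGL A) :
    ∃ n, k ≤ n ∧ ∃ g : GLn A n, x = StableGL.of A n g := by
  revert x
  refine DirectLimit.induction _ fun n g => ?_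
  exact ⟨max k n, le_max_left _ _, GLn.stab A n _ (le_max_right _ _) g, (StableGL.of_stab _ g).symm⟩

theorem GLn.stab_injective {m n : ℕ} (h : m ≤ n) : Function.Injective (GLn.stab A m n h) := by
  intro x y hxy
  ext i j
  have := congrArg (fun g : GLn A n =>
    (g : Matrix (Fin n) (Fin n) A) (Fin.castLE h i) (Fin.castLE h j)) hxy
  simpa [GLn.stab, stabMatrix] using this

/-- Allows the endpoints of a stable path to be compared as honest matrices of one finite size. -/
theorem StableGL.of_injective (n : ℕ) : Function.Injective (StableGL.of A n) :=
  DirectLimit.mk_injective (GLn.stab A) (fun _ _ h => GLn.stab_injective h) n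

end Compress

/-! ### The isomorphism `π₀(U(R)) ≅ KV₁(R)` -/

section Main

variable {R : Type u} [Ring R]

theorem piZeroUnitsToKV1_surjective (hR : IsPurelyInfiniteSimple R) :
    Function.Surjective (piZeroUnitsToKV1 R) := by
  intro x
  induction x using QuotientGroup.induction_on with | _ x
  revert x
  refine DirectLimit.induction _ fun n g => ?_
  obtain ⟨s, t, hst⟩ := hR.exists_isometries
  have h : (Matrix.of fun i _ => t i : Matrix (Fin n) (Fin 1) R) *
      (Matrix.of fun _ j => s j : Matrix (Fin 1) (Fin n) R) = 1 := by
    ext i j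
    simp [Matrix.mul_apply, hst, Matrix.one_apply, Fin.ext_iff]
  refine ⟨QuotientGroup.mk (GLn.oneEquiv R (compress _ _ h g)), ?_⟩
  change (QuotientGroup.mk (StableGL.ofUnits R _) : KV1 R) = _
  rw [StableGL.ofUnits_oneEquiv, mk_of_compress]
  rfl

/-- Compressing a matrix path along isometries below `f` connects `1` to `1 + s₀ (v - 1) t₀` in
U(R). As `v - 1` lives in the corner of `1 - f`, while `s₀` and `t₀` live under `f`, this unit and
`v` differ by a square-zero swap in `R`. -/
theorem mem_unitsComponent_of_fixing_idempotent (hR : IsPurelyInfiniteSimple R) {v : Rˣ} {f : R}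
    (hff : f * f = f) (hf0 : f ≠ 0) (hvf : (v : R) * f = f) (hfv : f * v = f)
    (hv : StableGL.ofUnits R v ∈ stableGLComponent R) : v ∈ unitsComponent R := by
  obtain ⟨w, hw0, hw1⟩ := (mem_stableGLComponent R).1 hv
  obtain ⟨n, hn, g, rfl⟩ := StableGL.exists_of 1 w
  rw [StableGL.map_of, ← map_one (StableGL.of R n)] at hw0
  have hg0 := StableGL.of_injective n hw0
  rw [StableGL.map_of, ← (GLn.oneEquiv R).apply_symm_apply v, StableGL.ofUnits_oneEquiv,
    ← StableGL.of_stab hn] at hw1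
  have hg1 := StableGL.of_injective n hw1
  obtain ⟨s, t, hst, hfs, htf⟩ := hR.exists_isometries_le hff hf0
  let σ : Matrix (Fin 1) (Fin n) R := Matrix.of fun _ j => s j
  let τ : Matrix (Fin n) (Fin 1) R := Matrix.of fun i _ => t i
  have h : τ * σ = 1 := by
    ext i j
    simp [σ, τ, Matrix.mul_apply, hst, Matrix.one_apply, Fin.ext_iff]
  have hC : τ.map Polynomial.C * σ.map Polynomial.C = 1 := by
    rw [← Matrix.map_mul, h, Matrix.map_one _ (map_zero _) (map_one _)]
  have hσ0 : (σ.map Polynomial.C).map (evalZero R) = σ := by ext; simp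
  have hτ0 : (τ.map Polynomial.C).map (evalZero R) = τ := by ext; simp
  have hσ1 : (σ.map Polynomial.C).map (evalOne R) = σ := by ext; simp [evalOne_C]
  have hτ1 : (τ.map Polynomial.C).map (evalOne R) = τ := by ext; simp [evalOne_C]
  -- The isometries are taken constant in `t`, so compression commutes with both evaluations, and
  -- `W` is a path of units from `1` to `V`.
  let W := compress (σ.map Polynomial.C) (τ.map Polynomial.C) hC g
  let V := compress σ τ h (GLn.stab R 1 n hn ((GLn.oneEquiv R).symm v))
  have hV : GLn.oneEquiv R V ∈ unitsComponent R := by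
    refine (mem_unitsComponent R).2 ⟨GLn.oneEquiv _ W, ?_, ?_⟩
    · rw [← GLn.oneEquiv_map, map_compress _ _ _ _ (by rw [hσ0, hτ0, h]), hg0, map_one, map_one]
    · rw [← GLn.oneEquiv_map, map_compress _ _ _ _ (by rw [hσ1, hτ1, h]), hg1]
      simp only [hσ1, hτ1, V]
  -- Only the entry `(0, 0)` of `diag(v, 1, …, 1) - 1` is nonzero. The factor `1 - f`, harmless
  -- because `(v - 1) f = 0`, is inserted to make the right-hand factor square-zero.
  have hVval : ((GLn.oneEquiv R V : Rˣ) : R) = 1 + s 0 * (v - 1) * ((1 - f) * t 0) := by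
    have hvf' : ((v : R) - 1) * f = 0 := by rw [sub_mul, hvf, one_mul, sub_self]
    let z : Fin n := ⟨0, hn⟩
    have hent : ∀ i j : Fin n, ((GLn.stab R 1 n hn ((GLn.oneEquiv R).symm v) :
        Matrix (Fin n) (Fin n) R) - 1) i j = if i = z then (if j = z then (v : R) - 1 else 0)
          else 0 := by
      intro i j
      have hv0 : ((GLn.oneEquiv R).symm v : Matrix (Fin 1) (Fin 1) R) 0 0 = v := rfl
      simp only [GLn.stab, stabMatrix, Matrix.sub_apply, Matrix.one_apply, z, Units.coe_map,
        MonoidHom.coe_mk, OneHom.coe_mk, Fin.ext_iff, Nat.lt_one_iff]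
      by_cases hi : (i : ℕ) = 0 <;> by_cases hj : (j : ℕ) = 0 <;>
        simp [hi, hj, hv0, eq_comm]
    have : ((GLn.oneEquiv R V : Rˣ) : R) = 1 + s 0 * (v - 1) * t 0 := by
      rw [GLn.coe_oneEquiv, coe_compress, Matrix.add_apply, Matrix.mul_apply,
        Finset.sum_eq_single z, Matrix.mul_apply, Finset.sum_eq_single z]
      · simp [hent, σ, τ, z]
      · intro i _ hi
        simp [hent, hi]
      · simp
      · intro j _ hj
        simp [Matrix.mul_apply, hent, hj]
      · simp
    rw [this]
    linear_combination (norm := noncomm_ring) s 0 * hvf' * t 0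
  have h00 : t 0 * s 0 = 1 := by simp [hst]
  have hvs : ((v : R) - 1) * s 0 = 0 := by
    rw [← hfs, ← mul_assoc, sub_mul, hvf, one_mul, sub_self, zero_mul]
  have h1 : s 0 * ((v : R) - 1) * (s 0 * ((v : R) - 1)) = 0 := by
    rw [mul_assoc, ← mul_assoc _ (s 0), hvs]; simp
  have h2 : (1 - f) * t 0 * ((1 - f) * t 0) = 0 := by
    have : t 0 * (1 - f) = 0 := by rw [mul_sub, htf, mul_one, sub_self]
    rw [mul_assoc, ← mul_assoc (t 0), this]; simp
  obtain ⟨v', hv', hvv'⟩ := exists_one_add_mul_swap (unitsComponent R)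
    (unipotent_mem_unitsComponent R) h1 h2 (GLn.oneEquiv R V) hVval
  -- The swapped unit is `1 + (1 - f) t₀ s₀ (v - 1) = 1 + (1 - f)(v - 1)`, which is `v` because `f v
  -- = f`.
  have : v' = v := by
    ext
    rw [hv']
    linear_combination (norm := noncomm_ring) (1 - f) * h00 * ((v : R) - 1) - hfv
  rw [this, (QuotientGroup.eq_one_iff _).2 hV, QuotientGroup.eq_one_iff] at hvv'
  exact hvv'

theorem piZeroUnitsToKV1_injective (hR : IsPurelyInfiniteSimple R) :
    Function.Injective (piZeroUnitsToKV1 R) := by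
  rw [injective_iff_map_eq_one]
  intro x hx
  induction x using QuotientGroup.induction_on with | _ u
  obtain ⟨v, f, hvu, hff, hf0, hvf, hfv⟩ := hR.exists_unit_fixing_idempotent (unitsComponent R)
    (unipotent_mem_unitsComponent R) u
  rw [← hvu] at hx ⊢
  exact (QuotientGroup.eq_one_iff _).2 (mem_unitsComponent_of_fixing_idempotent hR hff hf0 hvf hfv
    ((QuotientGroup.eq_one_iff _).1 hx))

end Main

/-! ### Comparing `K₁` and `KV₁` -/

section Regular

variable (R : Type u) [Ring R]

instance : CommGroup (KV1 R) where
  mul_comm := KV1.mul_comm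

/-- The canonical homomorphism `K₁(R) → KV₁(R)`. -/
def K1.toKV1 : K1 R →* KV1 R := Abelianization.lift (QuotientGroup.mk' (stableGLComponent R))

variable {R} {S : Type u} [Ring S] {T : Type u} [Ring T]

theorem StableGL.map_map (f : R →+* S) (g : S →+* T) (x : StableGL R) :
    StableGL.map g (StableGL.map f x) = StableGL.map (g.comp f) x := by
  revert x
  exact DirectLimit.induction _ fun n A => rfl

theorem StableGL.map_id (x : StableGL R) : StableGL.map (RingHom.id R) x = x := by
  revert x
  exact DirectLimit.induction _ fun n A => rfl

theorem K1.map_of (f : R →+* S) (x : StableGL R) :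
    K1.map f (Abelianization.of x) = Abelianization.of (StableGL.map f x) := rfl

theorem K1.map_map (f : R →+* S) (g : S →+* T) (x : K1 R) :
    K1.map g (K1.map f x) = K1.map (g.comp f) x := by
  induction x using QuotientGroup.induction_on with | _ x
  exact congrArg Abelianization.of (StableGL.map_map f g x)

theorem K1.map_id (x : K1 R) : K1.map (RingHom.id R) x = x := by
  induction x using QuotientGroup.induction_on with | _ x
  exact congrArg Abelianization.of (StableGL.map_id x)

variable (R) in
/-- `R[t]`, as `Polynomial R`, is isomorphic to the polynomial ring in one variable. -/
theorem exists_polynomial_ringEquiv_polyRing :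
    ∃ e : Polynomial R ≃+* PolyRing R 1,
      (e : Polynomial R →+* PolyRing R 1).comp Polynomial.C =
        AddMonoidAlgebra.singleZeroRingHom := by
  let E : ℕ ≃+ (Fin 1 →₀ ℕ) := (Finsupp.uniqueAddEquiv (M := ℕ) (0 : Fin 1)).symm
  refine ⟨(Polynomial.toFinsuppIso R).trans (AddMonoidAlgebra.mapDomainRingEquiv R E), ?_⟩
  ext r
  simp

/-- Surjectivity in one variable is all of K₁-regularity that the comparison with KV₁ uses. -/
theorem K1.map_C_surjective (hR : IsK1Regular R) :
    Function.Surjective (K1.map (Polynomial.C : R →+* Polynomial R)) := by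
  obtain ⟨e, he⟩ := exists_polynomial_ringEquiv_polyRing R
  intro x
  obtain ⟨y, hy⟩ := (hR 1).2 (K1.map (e : Polynomial R →+* PolyRing R 1) x)
  refine ⟨y, ?_⟩
  rw [← he, ← K1.map_map] at hy
  have := congrArg (K1.map (e.symm : PolyRing R 1 →+* Polynomial R)) hy
  rw [K1.map_map, K1.map_map _ _ x] at this
  simpa [K1.map_id] using this

/-- A path `w` from `1` to `g` has a constant class `h` in K₁(R[t]); evaluating at `0` gives `h =
1`, at `1` gives `h = [g]`, so `[g] = 1`. Surjectivity is clear, both groups being quotients of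
GL(R). -/
theorem K1.toKV1_bijective (hR : IsK1Regular R) : Function.Bijective (K1.toKV1 R) := by
  constructor
  · rw [injective_iff_map_eq_one]
    intro x hx
    induction x using QuotientGroup.induction_on with | _ g
    obtain ⟨w, hw0, hw1⟩ := (mem_stableGLComponent R).1 ((QuotientGroup.eq_one_iff _).1 hx)
    obtain ⟨h, hh⟩ := K1.map_C_surjective hR (Abelianization.of w)
    have h0 := congrArg (K1.map (evalZero R)) hh
    have h1 := congrArg (K1.map (evalOne R)) hh
    have e0 : (evalZero R).comp Polynomial.C = RingHom.id R := by ext; simp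
    have e1 : (evalOne R).comp Polynomial.C = RingHom.id R := by ext; simp [evalOne_C]
    rw [K1.map_map, e0, K1.map_id, K1.map_of, hw0, map_one] at h0
    rw [K1.map_map, e1, K1.map_id, K1.map_of, hw1, h0] at h1
    exact h1.symm
  · intro x
    induction x using QuotientGroup.induction_on with | _ g
    exact ⟨Abelianization.of g, rfl⟩

end Regular

end UnitalRing

end

theorem corollary2p8 (R : Type*) [Ring R] (hR : UnitalRing.IsPurelyInfiniteSimple R) :
    Function.Bijective (UnitalRing.piZeroUnitsToKV1 R) ∧
    (UnitalRing.IsK1Regular R →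
      ∃ e : UnitalRing.K1 R ≃* UnitalRing.PiZeroUnits R,
        (∀ u : Rˣ, e (Abelianization.of (UnitalRing.StableGL.ofUnits R u)) =
          (QuotientGroup.mk u : UnitalRing.PiZeroUnits R)) ∧
        (∀ g : UnitalRing.StableGL R, UnitalRing.piZeroUnitsToKV1 R (e (Abelianization.of g)) =
          (QuotientGroup.mk g : UnitalRing.KV1 R))) := by
  have hbij : Function.Bijective (UnitalRing.piZeroUnitsToKV1 R) :=
    ⟨UnitalRing.piZeroUnitsToKV1_injective hR, UnitalRing.piZeroUnitsToKV1_surjective hR⟩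
  refine ⟨hbij, fun hK => ?_⟩
  have h : ∀ g : UnitalRing.StableGL R,
      UnitalRing.piZeroUnitsToKV1 R ((MulEquiv.ofBijective _ hbij).symm
        (UnitalRing.K1.toKV1 R (Abelianization.of g))) = QuotientGroup.mk g := fun g =>
    (MulEquiv.ofBijective _ hbij).apply_symm_apply _
  -- The formula on units follows from `h` by injectivity of `piZeroUnitsToKV1`, since `[u]` and `e
  -- [u]` have the same image in KV₁.
  exact ⟨(MulEquiv.ofBijective _ (UnitalRing.K1.toKV1_bijective hK)).trans
    (MulEquiv.ofBijective _ hbij).symm, fun u => hbij.1 (h _), h⟩
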